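/- Let $n \ge 1$, let $\alpha_1,\dots,\alpha_n,\beta_1,\dots,\beta_n \in \mathbb{R}$, let $\Delta^n = \{x \in \mathbb{R}^n : x \ge 0,\ \sum_{i=1}^n x_i = 1\}$ be the standard simplex, and let $$q(x) = \sum_{i=1}^n 2\alpha_i x_i + \sum_{i=1}^n \beta_i x_i^2 .$$ Let $Q$ be the symmetric $n\times n$ matrix with entries $Q_{ij} = \alpha_i + \alpha_j$ for $i \neq j$ and $Q_{ii} = 2\alpha_i + \beta_i$, and let $E$ be the $n\times n$ all-ones matrix. Let $\mathcal{DNN}_n$ be the set of real symmetric $n \times n$ matrices that are both positive semidefinite and entrywise nonnegative, let $\mathcal{SPN}_n$ be the set of real symmetric $n\times n$ matrices that are the sum of a positive semidefinite matrix and an entrywise nonnegative matrix, and let $\mathcal{M}_n$ be the set of real symmetric $n\times n$ matrices $A=(a_{i,j})$ with $a_{i,j} \le a_{k,\ell}$ whenever $i \le k$, $j \le \ell$, $i \ne j$ and $k \neq \ell$. Then: 1. $q(x) = x^\top Q x$ for all $x \in \Delta^n$. 2. There is a permutation $\pi$ of $\{1,\dots,n\}$ with $\alpha_{\pi(1)}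 \le \dots \le \alpha_{\pi(n)}$, and for every such $\pi$ the matrix $(Q_{\pi(i),\pi(j)})_{i,j}$ lies in $\mathcal{M}_n$. 3. The doubly nonnegative relaxation of the problem of minimizing $q$ over $\Delta^n$ is tight, and the dual problem over $\mathcal{SPN}_n$ has the same value: $$\min_{x \in \Delta^n} q(x) \;=\; \min\{\operatorname{trace}(QX) : \operatorname{trace}(EX) = 1,\ X \in \mathcal{DNN}_n\} \;=\; \max\{\lambda \in \mathbb{R} : Q - \lambda E \in \mathcal{SPN}_n\},$$ where both minima and the maximum are attained. -/

import Mathlib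

open Matrix

namespace StQP

/-- The `n × n` matrix `E` with all entries equal to one. -/
def onesMatrix (n : ℕ) : Matrix (Fin n) (Fin n) ℝ := Matrix.of fun _ _ => 1

/-- The cone of doubly nonnegative matrices: (symmetric) positive semidefinite and entrywise
nonnegative. -/
def doublyNonnegative (n : ℕ) : Set (Matrix (Fin n) (Fin n) ℝ) :=
  {X | X.PosSemidef ∧ ∀ i j, 0 ≤ X i j}

/-- The cone of symmetric matrices that are the sum of a positive semidefinite matrix and an
entrywise nonnegative matrix. -/
def spnCone (n : ℕ) : Set (Matrix (Fin n) (Fin n) ℝ) :=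
  {A | A.IsSymm ∧ ∃ P N : Matrix (Fin n) (Fin n) ℝ,
    P.PosSemidef ∧ (∀ i j, 0 ≤ N i j) ∧ A = P + N}

/-- The set of symmetric matrices whose off-diagonal entries are nondecreasing in rows and
columns. -/
def orderedMatrices (n : ℕ) : Set (Matrix (Fin n) (Fin n) ℝ) :=
  {A | A.IsSymm ∧ ∀ i j k l : Fin n, i ≤ k → j ≤ l → i ≠ j → k ≠ l → A i j ≤ A k l}

/-- The set of objective values `Q • X = trace (Q X)` at the feasible points of the doubly
nonnegative relaxation of the standard quadratic program with matrix `Q`; its least element is the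
value of the relaxation. -/
def dnnValues {n : ℕ} (Q : Matrix (Fin n) (Fin n) ℝ) : Set ℝ :=
  (fun X => (Q * X).trace) '' {X | (onesMatrix n * X).trace = 1 ∧ X ∈ doublyNonnegative n}

/-- The feasible set of the dual problem over the SPN cone; its greatest element is the value of
that problem. -/
def spnFeasible {n : ℕ} (Q : Matrix (Fin n) (Fin n) ℝ) : Set ℝ :=
  {t | Q - t • onesMatrix n ∈ spnCone n}

/-- The separable quadratic objective `q(x) = ∑ 2 αᵢ xᵢ + ∑ βᵢ xᵢ²`. -/
def separableObjective {n : ℕ} (α β : Fin n → ℝ) (x : Fin n → ℝ) : ℝ :=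
  ∑ i, 2 * α i * x i + ∑ i, β i * x i ^ 2

/-- The symmetric matrix `Diag β + α eᵀ + e αᵀ` representing the separable objective on the
standard simplex. -/
def separableMatrix {n : ℕ} (α β : Fin n → ℝ) : Matrix (Fin n) (Fin n) ℝ :=
  Matrix.of fun i j => α i + α j + if i = j then β i else 0

end StQP

namespace StQP

/-! Let `z` be the minimum of the objective. `Q - zE` is copositive and again separable, with `α`
shifted by `z / 2`, so strong duality reduces to showing that a separable copositive matrix
dominates a Gram matrix entrywise (`exists_gram_le`).

Split the indices by the sign of `β`. Two concave indices (`β < 0`) never conflict: if `‖r i‖ ^ 2 ≤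
2 α i + β i` and likewise for `j`, then the inner product is at most `α i + α j`. So it suffices to
find one Gram matrix below the convex block that extends by each concave index separately.

That matrix comes from a minimizer `x` of the convex block with multiplier `τ`: lower each `a i` to
`τ - β i * x i`, which changes nothing on the support of `x`. The lowered block is positive
semidefinite (`exists_gram_eq`), each bordering stays copositive (`bordered_truncated_nonneg`), and
a separation argument supplies the new vector (`exists_inner_le`). -/

lemma single_apply_nonneg {ι : Type*} [DecidableEq ι] {t : ℝ} (ht : 0 ≤ t) (i j : ι) :
    0 ≤ (Pi.single i t : ι → ℝ) j := by
  rw [Pi.single_apply]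
  split_ifs
  exacts [ht, le_rfl]

/-! ### First-order conditions on the simplex. -/

section Core

variable {ι : Type*} [Fintype ι]

/-- A linear-plus-quadratic function nonnegative for small positive arguments has nonnegative
linear part. -/
lemma linear_coeff_nonneg {D B s₀ : ℝ} (hs₀ : 0 < s₀)
    (h : ∀ s, 0 ≤ s → s ≤ s₀ → 0 ≤ 2 * s * D + s ^ 2 * B) : 0 ≤ D := by
  by_contra! hD
  have hB : 0 < |B| + 1 := by positivity
  -- With `s * (|B| + 1) ≤ -D`, the factor `2 * D + s * B` is at most `D - s < 0`.
  have hpos : 0 < min s₀ (-D / (|B| + 1)) := lt_min hs₀ (div_pos (by linarith) hB)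
  set s := min s₀ (-D / (|B| + 1)) with hs
  have h1 := h s hpos.le (min_le_left _ _)
  have h2 : s * (|B| + 1) ≤ -D := by
    rw [← le_div_iff₀ hB]
    exact min_le_right _ _
  have h3 : 0 ≤ 2 * D + s * B := by
    by_contra! hneg
    nlinarith [mul_pos_of_neg_of_neg hneg (neg_lt_zero.mpr hpos)]
  nlinarith [mul_le_mul_of_nonneg_left (le_abs_self B) hpos.le]

/-- First-order optimality conditions for a separable quadratic on the standard simplex. -/
lemma exchange_of_isMinOn {a β x : ι → ℝ} (hx : x ∈ stdSimplex ℝ ι)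
    (hmin : ∀ y ∈ stdSimplex ℝ ι,
      ∑ i, (2 * a i * x i + β i * x i ^ 2) ≤ ∑ i, (2 * a i * y i + β i * y i ^ 2))
    {j : ι} (hj : 0 < x j) (k : ι) : a j + β j * x j ≤ a k + β k * x k := by
  classical
  -- Direction moving mass from `j` to `k`; steps of length up to `x j` stay in the simplex.
  set d : ι → ℝ := Pi.single k 1 - Pi.single j 1 with hd
  have hD : ∑ i, (a i + β i * x i) * d i = (a k + β k * x k) - (a j + β j * x j) := by
    simp [hd, mul_sub, Finset.sum_sub_distrib, Pi.single_apply]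
  suffices 0 ≤ ∑ i, (a i + β i * x i) * d i by linarith
  refine linear_coeff_nonneg (B := ∑ i, β i * d i ^ 2) hj fun s hs hsj => ?_
  have hmem : x + s • d ∈ stdSimplex ℝ ι := by
    refine ⟨fun i => ?_, ?_⟩
    · have h1 : 0 ≤ s * (Pi.single k 1 : ι → ℝ) i :=
        mul_nonneg hs (single_apply_nonneg zero_le_one k i)
      have h2 : s * (Pi.single j 1 : ι → ℝ) i ≤ x i := by
        rcases eq_or_ne i j with rfl | hij
        · simpa using hsj
        · simpa [hij] using hx.1 i
      simp only [hd, Pi.add_apply, Pi.smul_apply, Pi.sub_apply, smul_eq_mul, mul_sub]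
      linarith
    · have : ∑ i, d i = 0 := by simp [hd, Finset.sum_sub_distrib]
      simp [Finset.sum_add_distrib, ← Finset.mul_sum, this, hx.2]
  have := hmin _ hmem
  have e : ∑ i, (2 * a i * (x + s • d) i + β i * (x + s • d) i ^ 2) =
      ∑ i, (2 * a i * x i + β i * x i ^ 2) +
        (2 * s * ∑ i, (a i + β i * x i) * d i + s ^ 2 * ∑ i, β i * d i ^ 2) := by
    simp only [Finset.mul_sum, ← Finset.sum_add_distrib]
    refine Finset.sum_congr rfl fun i _ => ?_
    simp only [Pi.add_apply, Pi.smul_apply, smul_eq_mul]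
    ring
  linarith

lemma exists_isMinOn_separable [Nonempty ι] (a β : ι → ℝ) :
    ∃ x ∈ stdSimplex ℝ ι, ∀ y ∈ stdSimplex ℝ ι,
      ∑ i, (2 * a i * x i + β i * x i ^ 2) ≤ ∑ i, (2 * a i * y i + β i * y i ^ 2) := by
  classical
  have hne : (stdSimplex ℝ ι).Nonempty :=
    ⟨_, single_mem_stdSimplex ℝ (Classical.arbitrary ι)⟩
  have hc : ContinuousOn (fun y : ι → ℝ => ∑ i, (2 * a i * y i + β i * y i ^ 2))
      (stdSimplex ℝ ι) := by fun_prop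
  obtain ⟨x, hx, h⟩ := (isCompact_stdSimplex ℝ ι).exists_isMinOn hne hc
  exact ⟨x, hx, fun y hy => h hy⟩

/-- The minimizer of a separable quadratic on the simplex together with its multiplier `τ`. -/
lemma exists_multiplier [Nonempty ι] (a β : ι → ℝ) :
    ∃ x ∈ stdSimplex ℝ ι, ∃ τ : ℝ, (∀ k, τ ≤ a k + β k * x k) ∧
      ∀ k, 0 < x k → a k + β k * x k = τ := by
  obtain ⟨x, hx, hmin⟩ := exists_isMinOn_separable a β
  obtain ⟨j, hj⟩ : ∃ j, 0 < x j := by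
    by_contra! h
    have := Finset.sum_nonpos fun i (_ : i ∈ Finset.univ) => h i
    linarith [hx.2]
  exact ⟨x, hx, a j + β j * x j, exchange_of_isMinOn hx hmin hj, fun k hk =>
    le_antisymm (exchange_of_isMinOn hx hmin hk j) (exchange_of_isMinOn hx hmin hj k)⟩

/-! ### The convex block and its borderings. -/

/-- Lowering the linear coefficients `a` to `τ - β x` in the convex block preserves copositivity of
the bordered form. -/
lemma bordered_truncated_nonneg {a β x : ι → ℝ} {τ g₀ h₀ : ℝ} (hβ : ∀ i, 0 ≤ β i)
    (hx : x ∈ stdSimplex ℝ ι) (hτ : ∀ k, τ ≤ a k + β k * x k)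
    (hτ' : ∀ k, 0 < x k → a k + β k * x k = τ)
    (hcop : ∀ (y : ι → ℝ) (t : ℝ), (∀ i, 0 ≤ y i) → 0 ≤ t →
      0 ≤ ∑ i, β i * y i ^ 2 + 2 * (∑ i, a i * y i) * (∑ i, y i) +
        2 * t * (∑ i, a i * y i + g₀ * ∑ i, y i) + t ^ 2 * h₀)
    {y : ι → ℝ} {t : ℝ} (hy : ∀ i, 0 ≤ y i) (ht : 0 < t) :
    0 ≤ ∑ i, β i * y i ^ 2 + 2 * (∑ i, (τ - β i * x i) * y i) * (∑ i, y i) +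
        2 * t * (∑ i, a i * y i + g₀ * ∑ i, y i) + t ^ 2 * h₀ := by
  have hY0 : 0 ≤ ∑ i, y i := Finset.sum_nonneg fun i _ => hy i
  rcases hY0.eq_or_lt with hY | hY
  · have hy0 : y = 0 := by
      funext i
      exact (Finset.sum_eq_zero_iff_of_nonneg fun i _ => hy i).1 hY.symm i (Finset.mem_univ i)
    have := hcop y t hy ht.le
    simpa [hy0] using this
  · set Y := ∑ i, y i with hYdef
    have : Nonempty ι := by
      by_contra hne
      rw [not_nonempty_iff] at hne
      simp [hYdef] at hY
    -- Minimize the lowered bordered form over vectors `Y * p` of fixed mass `Y` and fixed `t`. If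
    -- `p` lives where lowering changes nothing, the minimum is a value of the original form, hence
    -- nonnegative.
    obtain ⟨p, hp, hmin⟩ := exists_isMinOn_separable
      (fun i => Y * (Y * (τ - β i * x i) + t * a i)) (fun i => Y ^ 2 * β i)
    have hsupp : ∀ j, 0 < p j → a j = τ - β j * x j := by
      intro j hj
      by_contra hne
      have hgt : τ - β j * x j < a j := lt_of_le_of_ne (by linarith [hτ j]) (Ne.symm hne)
      have hxj : x j = 0 := by
        by_contra h0
        exact hne (by linarith [hτ' j (lt_of_le_of_ne (hx.1 j) (Ne.symm h0))])
      -- Since `x j = 0` and `a j > τ`, exchanging `j` with any `k` in the support of `x` forces `Y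
      -- * p k` above `(Y + t) * x k`. Summing over `k` gives `Y + t ≤ Y`, contradicting `t > 0`.
      have hkey : ∀ k, (Y + t) * x k ≤ Y * p k := by
        intro k
        rcases (hx.1 k).eq_or_lt with hk | hk
        · rw [← hk, mul_zero]; exact mul_nonneg hY.le (hp.1 k)
        · have hex := exchange_of_isMinOn hp hmin hj k
          have hak : a k = τ - β k * x k := by linarith [hτ' k hk]
          have hex' : Y * (τ - β j * x j) + t * a j + β j * (Y * p j) ≤
              Y * (τ - β k * x k) + t * a k + β k * (Y * p k) := by
            refine le_of_mul_le_mul_left ?_ hY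
            linarith
          rw [hak] at hex'
          rw [hxj] at hex' hgt
          have h1 : 0 ≤ β j * (Y * p j) := by have := hβ j; positivity
          have h2 : t * τ < t * a j := mul_lt_mul_of_pos_left (by linarith) ht
          by_contra! hlt
          nlinarith [mul_le_mul_of_nonneg_left hlt.le (hβ k)]
      have := Finset.sum_le_sum fun k (_ : k ∈ Finset.univ) => hkey k
      rw [← Finset.mul_sum, ← Finset.mul_sum, hx.2, hp.2] at this
      linarith
    have hyp := hmin (fun i => y i / Y) ⟨fun i => div_nonneg (hy i) hY.le, by
      rw [← Finset.sum_div, ← hYdef, div_self hY.ne']⟩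
    have hL : ∑ i, (2 * (Y * (Y * (τ - β i * x i) + t * a i)) * p i + Y ^ 2 * β i * p i ^ 2) =
        ∑ i, β i * (Y * p i) ^ 2 + 2 * (∑ i, a i * (Y * p i)) * Y +
          2 * t * (∑ i, a i * (Y * p i)) := by
      simp only [Finset.mul_sum, Finset.sum_mul, ← Finset.sum_add_distrib]
      refine Finset.sum_congr rfl fun i _ => ?_
      rcases (hp.1 i).eq_or_lt with hi | hi
      · rw [← hi]; ring
      · rw [← hsupp i hi]; ring
    have hR : ∑ i, (2 * (Y * (Y * (τ - β i * x i) + t * a i)) * (y i / Y) +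
        Y ^ 2 * β i * (y i / Y) ^ 2) =
        ∑ i, β i * y i ^ 2 + 2 * (∑ i, (τ - β i * x i) * y i) * Y + 2 * t * (∑ i, a i * y i) := by
      simp only [Finset.mul_sum, Finset.sum_mul, ← Finset.sum_add_distrib]
      refine Finset.sum_congr rfl fun i _ => ?_
      field_simp
      ring
    have hsumP : ∑ i, Y * p i = Y := by rw [← Finset.mul_sum, hp.2, mul_one]
    have hc := hcop (fun i => Y * p i) t (fun i => mul_nonneg hY.le (hp.1 i)) ht.le
    rw [hsumP] at hc
    rw [hL, hR] at hyp
    linarith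

/-- If the Gram form of `R`, bordered by the column `g` and the corner `h`, is copositive, then a
vector of squared norm at most `h` has inner products with `R` bounded by `g`. -/
lemma exists_inner_le {E : Type*} [NormedAddCommGroup E] [InnerProductSpace ℝ E]
    [FiniteDimensional ℝ E] (R : ι → E) (g : ι → ℝ) {h : ℝ} (hh : 0 ≤ h)
    (hcop : ∀ (y : ι → ℝ) (t : ℝ), (∀ i, 0 ≤ y i) → 0 < t →
      0 ≤ ‖∑ i, y i • R i‖ ^ 2 + 2 * t * (∑ i, g i * y i) + t ^ 2 * h) :
    ∃ r : E, ‖r‖ ^ 2 ≤ h ∧ ∀ i, inner ℝ (R i) r ≤ g i := by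
  classical
  by_contra! hno
  let L : E →ₗ[ℝ] (ι → ℝ) := LinearMap.pi fun i => (innerSL ℝ (R i)).toLinearMap
  have hL : ∀ r i, L r i = inner ℝ (R i) r := fun r i => rfl
  set K : Set (ι → ℝ) := L '' Metric.closedBall 0 (√h)
  have hball : ∀ r : E, r ∈ Metric.closedBall (0 : E) (√h) ↔ ‖r‖ ^ 2 ≤ h := fun r => by
    rw [mem_closedBall_zero_iff, Real.le_sqrt (norm_nonneg r) hh]
  have hKc : Convex ℝ K := (convex_closedBall _ _).linear_image L
  have hKcomp : IsCompact K :=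
    (isCompact_closedBall _ _).image L.continuous_of_finiteDimensional
  -- A suitable `r` is a common point of the image of the ball and the orthant below `g`; otherwise
  -- separate them. The orthant makes the normal `y` nonnegative.
  have hdisj : Disjoint K (Set.Iic g) := by
    rw [Set.disjoint_left]
    rintro _ ⟨r, hr, rfl⟩ hle
    obtain ⟨i, hi⟩ := hno r ((hball r).1 hr)
    exact absurd (hle i) (not_le.2 hi)
  obtain ⟨f, u, v, hfu, huv, hfv⟩ :=
    geometric_hahn_banach_compact_closed hKc hKcomp (convex_Iic g) isClosed_Iic hdisj
  set y : ι → ℝ := fun i => -f (Pi.single i 1) with hydef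
  have hf : ∀ w : ι → ℝ, f w = -∑ i, w i * y i := by
    intro w
    conv_lhs => rw [pi_eq_sum_univ' w]
    simp [hydef, map_sum]
  have hy : ∀ i, 0 ≤ y i := by
    intro i
    by_contra! hneg
    have hb : ∀ s : ℝ, 0 ≤ s → v < f g + s * y i := by
      intro s hs
      have hm : g - s • Pi.single i 1 ∈ Set.Iic g := by
        rw [Set.mem_Iic, sub_le_self_iff]
        exact smul_nonneg hs (Pi.single_nonneg.2 zero_le_one)
      have := hfv _ hm
      simpa [hydef, sub_eq_add_neg] using this
    have h0 := hfv g (Set.mem_Iic.2 le_rfl)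
    have := hb ((f g - v) / (-y i)) (div_nonneg (by linarith) (by linarith))
    have e : (f g - v) / (-y i) * y i = -(f g - v) := by
      have := hneg.ne
      field_simp
    linarith
  set z := ∑ i, y i • R i with hz
  have hin : ∀ r : E, ‖r‖ ^ 2 ≤ h → ∑ i, g i * y i < inner ℝ z r := by
    intro r hr
    have h1 := hfu (L r) ⟨r, (hball r).2 hr, rfl⟩
    have h2 := hfv g (Set.mem_Iic.2 le_rfl)
    rw [hf] at h1 h2
    have e : ∑ i, L r i * y i = inner ℝ z r := by
      rw [hz, sum_inner]
      refine Finset.sum_congr rfl fun i _ => ?_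
      rw [real_inner_smul_left, hL, mul_comm]
    linarith
  have hneg : ∑ i, g i * y i < 0 := by simpa using hin 0 (by simpa using hh)
  set γ := ∑ i, g i * y i
  -- Each case picks a `t > 0` making `‖z‖ ^ 2 + 2 * t * γ + t ^ 2 * h` negative: large `t` if `h =
  -- 0`, and the minimizer `-γ / h` if `z = 0`. Otherwise testing `r = -(√h / ‖z‖) • z` gives `γ <
  -- -√h * ‖z‖`, and `t = ‖z‖ / √h` works.
  rcases hh.eq_or_lt with h0 | hpos
  · have := hcop y ((‖z‖ ^ 2 + 1) / (-γ)) hy (div_pos (by positivity) (by linarith))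
    rw [← h0] at this
    have e : (‖z‖ ^ 2 + 1) / (-γ) * γ = -(‖z‖ ^ 2 + 1) := by
      have := hneg.ne
      field_simp
    nlinarith [sq_nonneg ‖z‖]
  · rcases eq_or_ne z 0 with hz0 | hz0
    · have := hcop y (-γ / h) hy (div_pos (by linarith) hpos)
      rw [← hz, hz0, norm_zero] at this
      have e : 2 * (-γ / h) * γ + (-γ / h) ^ 2 * h = -(γ ^ 2 / h) := by
        field_simp
        ring
      have : 0 < γ ^ 2 / h := div_pos (sq_pos_of_neg hneg) hpos
      linarith
    · have hzn : 0 < ‖z‖ := norm_pos_iff.2 hz0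
      have hsq : 0 < √h := Real.sqrt_pos.2 hpos
      have hss : √h ^ 2 = h := Real.sq_sqrt hh
      have h1 := hin (-((√h / ‖z‖) • z)) (by
        rw [norm_neg, norm_smul, Real.norm_of_nonneg (by positivity), div_mul_cancel₀ _ hzn.ne',
          hss])
      rw [inner_neg_right, real_inner_smul_right, real_inner_self_eq_norm_sq] at h1
      have e1 : √h / ‖z‖ * ‖z‖ ^ 2 = √h * ‖z‖ := by field_simp
      have h2 := hcop y (‖z‖ / √h) hy (by positivity)
      have e2 : (‖z‖ / √h) ^ 2 * h = ‖z‖ ^ 2 := by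
        rw [div_pow, hss]; field_simp
      have h3 : ‖z‖ / √h * γ < ‖z‖ / √h * (-(√h * ‖z‖)) :=
        mul_lt_mul_of_pos_left (by linarith) (by positivity)
      have e3 : ‖z‖ / √h * (-(√h * ‖z‖)) = -‖z‖ ^ 2 := by field_simp
      rw [← hz] at h2
      nlinarith

/-- Vectors realizing the truncated convex block as a Gram matrix. -/
lemma exists_gram_eq [DecidableEq ι] {β x : ι → ℝ} {τ : ℝ} (hβ : ∀ i, 0 ≤ β i)
    (hμ : 0 ≤ 2 * τ - ∑ k, β k * x k ^ 2) :
    ∃ R : ι → EuclideanSpace ℝ (Option ι), ∀ i j, inner ℝ (R i) (R j) =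
      (τ - β i * x i) + (τ - β j * x j) + if i = j then β i else 0 := by
  -- The coordinates `√(β k) * (δ_ik - x k)` produce the wanted entries plus the constant `∑ β k * x
  -- k ^ 2`; the extra `none` coordinate corrects the constant to `2 * τ`.
  refine ⟨fun i => WithLp.toLp 2 fun o => o.elim (√(2 * τ - ∑ k, β k * x k ^ 2))
    fun k => √(β k) * ((if i = k then 1 else 0) - x k), fun i j => ?_⟩
  have hs : ∀ k, √(β k) * ((if j = k then 1 else 0) - x k) *
      (√(β k) * ((if i = k then 1 else 0) - x k)) =
      (if i = k then (if i = j then β k else 0) - β k * x k else 0) -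
        (if j = k then β k * x k else 0) + β k * x k ^ 2 := by
    intro k
    have h1 : √(β k) * √(β k) = β k := Real.mul_self_sqrt (hβ k)
    rw [mul_mul_mul_comm, h1]
    by_cases hi : i = k
    · subst hi
      by_cases hj : j = i
      · subst hj
        simp only [if_true]
        ring
      · simp only [if_true, hj, Ne.symm hj, if_false]
        ring
    · by_cases hj : j = k <;> simp only [hi, hj, if_true, if_false] <;> ring
  simp only [PiLp.inner_apply, RCLike.inner_apply, conj_trivial, Fintype.sum_option,
    Option.elim_none, Option.elim_some, hs, Real.mul_self_sqrt hμ, Finset.sum_add_distrib,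
    Finset.sum_sub_distrib, Finset.sum_ite_eq, Finset.mem_univ, if_true]
  ring

/-- The convex block of a separable copositive matrix dominates a Gram matrix that extends to every
copositive bordering. -/
lemma exists_extendable_gram [Nonempty ι] [DecidableEq ι] {a β : ι → ℝ} (hβ : ∀ i, 0 ≤ β i)
    (hcop : ∀ y : ι → ℝ, (∀ i, 0 ≤ y i) →
      0 ≤ ∑ i, β i * y i ^ 2 + 2 * (∑ i, a i * y i) * ∑ i, y i) :
    ∃ R : ι → EuclideanSpace ℝ (Option ι),
      (∀ i j, inner ℝ (R i) (R j) ≤ a i + a j + if i = j then β i else 0) ∧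
      ∀ g₀ h₀ : ℝ, (∀ (y : ι → ℝ) (t : ℝ), (∀ i, 0 ≤ y i) → 0 ≤ t →
        0 ≤ ∑ i, β i * y i ^ 2 + 2 * (∑ i, a i * y i) * (∑ i, y i) +
          2 * t * (∑ i, a i * y i + g₀ * ∑ i, y i) + t ^ 2 * h₀) →
        ∃ r, ‖r‖ ^ 2 ≤ h₀ ∧ ∀ i, inner ℝ (R i) r ≤ a i + g₀ := by
  obtain ⟨x, hx, τ, hτ, hτ'⟩ := exists_multiplier a β
  have hsum : ∑ i, a i * x i + ∑ i, β i * x i ^ 2 = τ := by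
    have : ∑ i, (a i * x i + β i * x i ^ 2) = ∑ i, τ * x i := by
      refine Finset.sum_congr rfl fun i _ => ?_
      rcases (hx.1 i).eq_or_lt with hi | hi
      · rw [← hi]; ring
      · rw [← hτ' i hi]; ring
    rwa [Finset.sum_add_distrib, ← Finset.mul_sum, hx.2, mul_one] at this
  -- By `hsum` this quantity is the objective value at `x`, nonnegative by copositivity.
  have hμ : 0 ≤ 2 * τ - ∑ k, β k * x k ^ 2 := by
    have := hcop x hx.1
    rw [hx.2] at this
    linarith
  obtain ⟨R, hR⟩ := exists_gram_eq hβ hμ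
  refine ⟨R, fun i j => ?_, fun g₀ h₀ hb => ?_⟩
  · rw [hR]
    linarith [hτ i, hτ j]
  · refine exists_inner_le R _ (by simpa using hb 0 1 (by simp) zero_le_one) fun y t hy ht => ?_
    have := bordered_truncated_nonneg hβ hx hτ hτ' hb hy ht
    have e : ‖∑ i, y i • R i‖ ^ 2 =
        ∑ i, β i * y i ^ 2 + 2 * (∑ i, (τ - β i * x i) * y i) * (∑ i, y i) := by
      rw [← real_inner_self_eq_norm_sq, sum_inner]
      simp only [inner_sum, real_inner_smul_left, real_inner_smul_right, hR, mul_add,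
        Finset.sum_add_distrib, mul_ite, mul_zero, Finset.sum_ite_eq, Finset.mem_univ, if_true]
      have e1 : ∑ i, ∑ j, y j * (y i * (τ - β i * x i)) =
          (∑ i, (τ - β i * x i) * y i) * ∑ i, y i := by
        rw [Finset.sum_mul_sum]
        exact Finset.sum_congr rfl fun i _ => Finset.sum_congr rfl fun j _ => by ring
      have e2 : ∑ i, ∑ j, y j * (y i * (τ - β j * x j)) =
          (∑ i, (τ - β i * x i) * y i) * ∑ i, y i := by
        rw [Finset.sum_comm, ← e1]
        exact Finset.sum_congr rfl fun i _ => Finset.sum_congr rfl fun j _ => by ring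
      have e3 : ∑ i, y i * (y i * β i) = ∑ i, β i * y i ^ 2 :=
        Finset.sum_congr rfl fun i _ => by ring
      rw [e1, e2, e3]
      ring
    have e' : ∑ i, (a i + g₀) * y i = ∑ i, a i * y i + g₀ * ∑ i, y i := by
      simp only [add_mul, Finset.sum_add_distrib, Finset.mul_sum]
    rw [e, e']
    exact this

end Core

/-! ### Gluing convex and concave indices. -/

lemma sum_extend {n : ℕ} (p : Fin n → Prop) [DecidablePred p] (F : Fin n → ℝ → ℝ)
    (y : {j // p j} → ℝ) (u : Fin n → ℝ) :
    ∑ j, F j (if h : p j then y ⟨j, h⟩ else u j) =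
      ∑ c : {j // p j}, F c (y c) + ∑ c : {j // ¬ p j}, F c (u c) := by
  rw [← Fintype.sum_subtype_add_sum_subtype p]
  congr 1
  · exact Finset.sum_congr rfl fun c _ => by rw [dif_pos c.2]
  · exact Finset.sum_congr rfl fun c _ => by rw [dif_neg c.2]

/-- A separable copositive matrix dominates a Gram matrix entrywise. -/
lemma exists_gram_le {n : ℕ} {α β : Fin n → ℝ}
    (hcop : ∀ y : Fin n → ℝ, (∀ i, 0 ≤ y i) →
      0 ≤ ∑ i, β i * y i ^ 2 + 2 * (∑ i, α i * y i) * ∑ i, y i) :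
    ∃ (κ : Type) (_ : Fintype κ) (r : Fin n → EuclideanSpace ℝ κ),
      ∀ i j, inner ℝ (r i) (r j) ≤ separableMatrix α β i j := by
  classical
  have hdiag : ∀ i, 0 ≤ 2 * α i + β i := by
    intro i
    have := hcop (Pi.single i 1) (single_apply_nonneg zero_le_one i)
    simp [Pi.single_apply] at this
    linarith
  rcases isEmpty_or_nonempty {j // 0 ≤ β j} with hC | hC
  -- If every `β i` is negative, the diagonal condition gives `α i ≥ 0`, so the matrix is entrywise
  -- nonnegative and zero vectors suffice.
  · refine ⟨Fin 0, inferInstance, 0, fun i j => ?_⟩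
    have hα : ∀ i, 0 ≤ α i := fun i => by
      have : β i < 0 := not_le.1 fun h => hC.false ⟨i, h⟩
      linarith [hdiag i]
    rcases eq_or_ne i j with rfl | hij
    · simp only [Pi.zero_apply, inner_zero_left, separableMatrix, Matrix.of_apply, if_true]
      linarith [hdiag i]
    · simp only [Pi.zero_apply, inner_zero_left, separableMatrix, Matrix.of_apply, hij, if_false]
      linarith [hα i, hα j]
  · have hext : ∀ (y : {j // 0 ≤ β j} → ℝ) (u : Fin n → ℝ), (∀ c, 0 ≤ y c) → (∀ j, 0 ≤ u j) →
        0 ≤ (∑ c : {j // 0 ≤ β j}, β c * y c ^ 2 + ∑ c : {j // ¬ 0 ≤ β j}, β c * u c ^ 2) +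
          2 * (∑ c : {j // 0 ≤ β j}, α c * y c + ∑ c : {j // ¬ 0 ≤ β j}, α c * u c) *
            (∑ c : {j // 0 ≤ β j}, y c + ∑ c : {j // ¬ 0 ≤ β j}, u c) := by
      intro y u hy hu
      have := hcop (fun j => if h : 0 ≤ β j then y ⟨j, h⟩ else u j) fun j => by
        split_ifs
        exacts [hy _, hu _]
      rwa [sum_extend (fun j => 0 ≤ β j) (fun j s => β j * s ^ 2),
        sum_extend (fun j => 0 ≤ β j) (fun j s => α j * s),
        sum_extend (fun j => 0 ≤ β j) (fun _ s => s)] at this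
    obtain ⟨R, hR, hRext⟩ := exists_extendable_gram (ι := {j // 0 ≤ β j}) (a := fun c => α c)
      (β := fun c => β c) (fun c => c.2) fun y hy => by
        simpa using hext y 0 hy fun _ => le_rfl
    have hT : ∀ i, ¬ 0 ≤ β i → ∃ r, ‖r‖ ^ 2 ≤ 2 * α i + β i ∧
        ∀ c : {j // 0 ≤ β j}, inner ℝ (R c) r ≤ α c + α i := by
      intro i hi
      -- The bordering by `i` is copositivity on vectors supported on the convex block and `i`, with
      -- corner `2 * α i + β i`.
      refine hRext (α i) _ fun y t hy ht => ?_
      have := hext y (Pi.single i t) hy (single_apply_nonneg ht i)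
      have hs : ∀ F : Fin n → ℝ → ℝ, (∀ j, F j 0 = 0) →
          ∑ c : {j // ¬ 0 ≤ β j}, F c ((Pi.single i t : Fin n → ℝ) c) = F i t := by
        intro F hF
        rw [Fintype.sum_eq_single (⟨i, hi⟩ : {j // ¬ 0 ≤ β j})]
        · simp
        · intro c hc
          have : (c : Fin n) ≠ i := fun h => hc (Subtype.ext h)
          simp [this, hF]
      rw [hs (fun j s => β j * s ^ 2) (by simp), hs (fun j s => α j * s) (by simp),
        hs (fun _ s => s) (by simp)] at this
      linarith
    choose! r hr hrR using hT
    refine ⟨_, inferInstance, fun i => if h : 0 ≤ β i then R ⟨i, h⟩ else r i, fun i j => ?_⟩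
    simp only [separableMatrix, Matrix.of_apply]
    by_cases hi : 0 ≤ β i <;> by_cases hj : 0 ≤ β j
    · rw [dif_pos hi, dif_pos hj]
      simpa using hR ⟨i, hi⟩ ⟨j, hj⟩
    · have hij : i ≠ j := by rintro rfl; exact hj hi
      rw [dif_pos hi, dif_neg hj, if_neg hij, add_zero]
      exact hrR j hj ⟨i, hi⟩
    · have hij : i ≠ j := by rintro rfl; exact hi hj
      rw [dif_neg hi, dif_pos hj, if_neg hij, add_zero, real_inner_comm, add_comm]
      exact hrR i hi ⟨j, hj⟩
    · rw [dif_neg hi, dif_neg hj]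
      rcases eq_or_ne i j with rfl | hij
      · rw [real_inner_self_eq_norm_sq, if_pos rfl]
        linarith [hr i hi]
      -- Cauchy–Schwarz and AM–GM bound the inner product by `α i + α j + (β i + β j) / 2`, and both
      -- `β` are negative.
      · rw [if_neg hij]
        have h1 := real_inner_le_norm (r i) (r j)
        have h2 := hr i hi
        have h3 := hr j hj
        nlinarith [sq_nonneg (‖r i‖ - ‖r j‖)]

/-! ### Matrix form, strong and weak duality. -/

open Matrix

lemma dotProduct_separableMatrix_mulVec {n : ℕ} (α β y : Fin n → ℝ) :
    y ⬝ᵥ (separableMatrix α β *ᵥ y) =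
      ∑ i, β i * y i ^ 2 + 2 * (∑ i, α i * y i) * ∑ i, y i := by
  simp only [dotProduct, mulVec, separableMatrix, Matrix.of_apply, Finset.mul_sum, add_mul,
    mul_add, Finset.sum_add_distrib, ite_mul, zero_mul, Finset.sum_ite_eq,
    Finset.mem_univ, if_true]
  have e1 : ∑ i, ∑ j, y i * (α i * y j) = (∑ i, α i * y i) * ∑ i, y i := by
    rw [Finset.sum_mul_sum]
    exact Finset.sum_congr rfl fun i _ => Finset.sum_congr rfl fun j _ => by ring
  have e2 : ∑ i, ∑ j, y i * (α j * y j) = (∑ i, α i * y i) * ∑ i, y i := by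
    rw [Finset.sum_comm, ← e1]
    exact Finset.sum_congr rfl fun i _ => Finset.sum_congr rfl fun j _ => by ring
  have e3 : ∑ i, y i * (β i * y i) = ∑ i, β i * y i ^ 2 :=
    Finset.sum_congr rfl fun i _ => by ring
  rw [e1, e2, e3, ← Finset.mul_sum, ← Finset.mul_sum]
  ring

lemma separableObjective_eq_sum {n : ℕ} (α β x : Fin n → ℝ) :
    separableObjective α β x = ∑ i, (2 * α i * x i + β i * x i ^ 2) :=
  Finset.sum_add_distrib.symm

lemma separableObjective_eq {n : ℕ} (α β : Fin n → ℝ) {x : Fin n → ℝ}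
    (hx : x ∈ stdSimplex ℝ (Fin n)) :
    separableObjective α β x = x ⬝ᵥ (separableMatrix α β *ᵥ x) := by
  rw [dotProduct_separableMatrix_mulVec, hx.2, separableObjective]
  simp only [mul_assoc, ← Finset.mul_sum]
  ring

lemma separableMatrix_isSymm {n : ℕ} (α β : Fin n → ℝ) : (separableMatrix α β).IsSymm := by
  refine Matrix.IsSymm.ext fun i j => ?_
  simp only [separableMatrix, Matrix.of_apply]
  rcases eq_or_ne i j with rfl | h
  · rfl
  · rw [if_neg h, if_neg h.symm, add_comm (α j)]

lemma separableMatrix_submatrix_mem {n : ℕ} {α : Fin n → ℝ} (β : Fin n → ℝ)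
    {σ : Equiv.Perm (Fin n)} (hσ : Monotone (α ∘ σ)) :
    (separableMatrix α β).submatrix σ σ ∈ orderedMatrices n := by
  refine ⟨(separableMatrix_isSymm α β).submatrix σ, fun i j k l hik hjl hij hkl => ?_⟩
  have h1 : α (σ i) ≤ α (σ k) := hσ hik
  have h2 : α (σ j) ≤ α (σ l) := hσ hjl
  simp only [separableMatrix, submatrix_apply, Matrix.of_apply, σ.injective.eq_iff, hij, hkl,
    if_false]
  linarith

/-- Subtracting a multiple of `E` stays in the separable class, so the Gram bound applies to dual
slack matrices. -/
lemma sub_half_separableMatrix {n : ℕ} (α β : Fin n → ℝ) (z : ℝ) :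
    separableMatrix (fun i => α i - z / 2) β = separableMatrix α β - z • onesMatrix n := by
  ext i j
  simp only [separableMatrix, onesMatrix, Matrix.of_apply, Matrix.sub_apply, Matrix.smul_apply,
    smul_eq_mul]
  ring

/-- A lower bound for the separable objective on the simplex is feasible for the SPN dual. -/
lemma mem_spnFeasible {n : ℕ} {α β : Fin n → ℝ} {z : ℝ}
    (hz : ∀ y ∈ stdSimplex ℝ (Fin n), z ≤ separableObjective α β y) :
    z ∈ spnFeasible (separableMatrix α β) := by
  have hcop : ∀ y : Fin n → ℝ, (∀ i, 0 ≤ y i) →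
      0 ≤ ∑ i, β i * y i ^ 2 + 2 * (∑ i, (α i - z / 2) * y i) * ∑ i, y i := by
    intro y hy
    have hY0 : 0 ≤ ∑ i, y i := Finset.sum_nonneg fun i _ => hy i
    rcases hY0.eq_or_lt with hY | hY
    · have hy0 : y = 0 := by
        funext i
        exact (Finset.sum_eq_zero_iff_of_nonneg fun i _ => hy i).1 hY.symm i (Finset.mem_univ i)
      simp [hy0]
    · have h := hz (fun i => y i / ∑ i, y i) ⟨fun i => div_nonneg (hy i) hY.le, by
        rw [← Finset.sum_div, div_self hY.ne']⟩
      set Y := ∑ i, y i with hYdef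
      have e1 : ∑ i, (α i - z / 2) * y i = ∑ i, α i * y i - z / 2 * Y := by
        rw [hYdef, Finset.mul_sum, ← Finset.sum_sub_distrib]
        exact Finset.sum_congr rfl fun i _ => by ring
      -- Homogenization: scaling by the total mass turns the bound on the simplex into copositivity
      -- on the orthant.
      have e2 : Y ^ 2 * separableObjective α β (fun i => y i / Y) =
          ∑ i, β i * y i ^ 2 + 2 * (∑ i, α i * y i) * Y := by
        rw [separableObjective_eq_sum]
        simp only [Finset.mul_sum, Finset.sum_mul, ← Finset.sum_add_distrib]
        refine Finset.sum_congr rfl fun i _ => ?_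
        field_simp
        ring
      have := mul_le_mul_of_nonneg_left h (sq_nonneg Y)
      rw [e2] at this
      rw [e1]
      linarith
  obtain ⟨κ, _, r, hr⟩ := exists_gram_le hcop
  rw [sub_half_separableMatrix] at hr
  change separableMatrix α β - z • onesMatrix n ∈ spnCone n
  refine ⟨?_, Matrix.gram ℝ r, separableMatrix α β - z • onesMatrix n - Matrix.gram ℝ r,
    Matrix.posSemidef_gram ℝ r, fun i j => ?_, by abel⟩
  · rw [← sub_half_separableMatrix]
    exact separableMatrix_isSymm _ _
  · rw [Matrix.sub_apply, sub_nonneg]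
    exact hr i j

/-- The trace is the quadratic form of the Hadamard product at the all-ones vector, so the Schur
product theorem applies. -/
lemma trace_mul_nonneg_of_posSemidef {n : ℕ} {P X : Matrix (Fin n) (Fin n) ℝ}
    (hP : P.PosSemidef) (hX : X.PosSemidef) : 0 ≤ (P * X).trace := by
  have h := (hP.hadamard hX).dotProduct_mulVec_nonneg (fun _ => 1)
  have e : ∀ i j, X j i = X i j := fun i j => by simpa using hX.1.apply i j
  simp only [trace, diag_apply, mul_apply, e]
  simpa [dotProduct, mulVec, hadamard_apply] using h

/-- Weak duality between the doubly nonnegative relaxation and the SPN problem. -/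
lemma le_of_mem_spnFeasible_of_mem_dnnValues {n : ℕ} {Q : Matrix (Fin n) (Fin n) ℝ} {t v : ℝ}
    (ht : t ∈ spnFeasible Q) (hv : v ∈ dnnValues Q) : t ≤ v := by
  obtain ⟨-, P, N, hP, hN, hPN⟩ := ht
  obtain ⟨X, ⟨hX1, hXpsd, hX0⟩, rfl⟩ := hv
  have h1 : 0 ≤ (P * X).trace := trace_mul_nonneg_of_posSemidef hP hXpsd
  have h2 : 0 ≤ (N * X).trace := by
    simp only [trace, diag_apply, mul_apply]
    exact Finset.sum_nonneg fun i _ => Finset.sum_nonneg fun j _ => mul_nonneg (hN i j) (hX0 j i)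
  have h3 : ((Q - t • onesMatrix n) * X).trace = (Q * X).trace - t := by
    rw [Matrix.sub_mul, Matrix.smul_mul, trace_sub, trace_smul, hX1, smul_eq_mul, mul_one]
  rw [hPN, Matrix.add_mul, trace_add] at h3
  change t ≤ (Q * X).trace
  linarith

lemma trace_mul_vecMulVec_self {n : ℕ} (A : Matrix (Fin n) (Fin n) ℝ) (x : Fin n → ℝ) :
    (A * vecMulVec x x).trace = x ⬝ᵥ (A *ᵥ x) := by
  rw [mul_vecMulVec, trace_vecMulVec, dotProduct_comm]

lemma dotProduct_mulVec_mem_dnnValues {n : ℕ} (Q : Matrix (Fin n) (Fin n) ℝ) {x : Fin n → ℝ}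
    (hx : x ∈ stdSimplex ℝ (Fin n)) : x ⬝ᵥ (Q *ᵥ x) ∈ dnnValues Q := by
  refine ⟨vecMulVec x x, ⟨?_, ?_, fun i j => mul_nonneg (hx.1 i) (hx.1 j)⟩,
    trace_mul_vecMulVec_self Q x⟩
  · rw [trace_mul_vecMulVec_self]
    simp [dotProduct, mulVec, onesMatrix, hx.2]
  · simpa using posSemidef_vecMulVec_self_star x

end StQP

open Matrix in
theorem proposition5p6 (n : ℕ) (hn : 1 ≤ n) (α β : Fin n → ℝ) :
    (∀ x ∈ stdSimplex ℝ (Fin n),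
      StQP.separableObjective α β x = x ⬝ᵥ (StQP.separableMatrix α β *ᵥ x)) ∧
    (∃ σ : Equiv.Perm (Fin n), Monotone (α ∘ σ)) ∧
    (∀ σ : Equiv.Perm (Fin n), Monotone (α ∘ σ) →
      (StQP.separableMatrix α β).submatrix σ σ ∈ StQP.orderedMatrices n) ∧
    ∃ z : ℝ,
      IsLeast (StQP.separableObjective α β '' stdSimplex ℝ (Fin n)) z ∧
      IsLeast (StQP.dnnValues (StQP.separableMatrix α β)) z ∧
      IsGreatest (StQP.spnFeasible (StQP.separableMatrix α β)) z := by
  refine ⟨fun x hx => StQP.separableObjective_eq α β hx, ⟨Tuple.sort α, Tuple.monotone_sort α⟩,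
    fun σ hσ => StQP.separableMatrix_submatrix_mem β hσ, ?_⟩
  have : Nonempty (Fin n) := ⟨⟨0, hn⟩⟩
  obtain ⟨x, hx, hmin⟩ := StQP.exists_isMinOn_separable α β
  simp only [← StQP.separableObjective_eq_sum] at hmin
  have hspn := StQP.mem_spnFeasible hmin
  have hdnn := StQP.dotProduct_mulVec_mem_dnnValues (StQP.separableMatrix α β) hx
  rw [← StQP.separableObjective_eq α β hx] at hdnn
  refine ⟨StQP.separableObjective α β x, ⟨⟨x, hx, rfl⟩, ?_⟩,
    ⟨hdnn, fun v hv => StQP.le_of_mem_spnFeasible_of_mem_dnnValues hspn hv⟩,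
    ⟨hspn, fun t ht => StQP.le_of_mem_spnFeasible_of_mem_dnnValues ht hdnn⟩⟩
  rintro _ ⟨y, hy, rfl⟩
  exact hmin y hy
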